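/- Let $\eta>0$ and $\mathbb C_\eta=\{z\in\mathbb C:|\operatorname{Re}z|<\eta\}$. Let $\mathcal L_\eta$ be the set of meromorphic functions $U$ on $\mathbb C_\eta$, with set of poles $\mathcal A$, such that 1. every pole of $U$ is simple; 2. $\mathcal A$ is infinite and separated, i.e. $\inf\{|a-b| : a,b\in\mathcal A,\ a\ne b\}>0$; 3. there are $l_1,l_2>0$ with $\sup_{a\in\mathcal A}(1+|a|)^{l_1}\operatorname{Re}(a)<0$ and $\sup_{a\in\mathcal A}(1+|a|)^{l_2}\operatorname{Re}(a)=0$; 4. there are $C_0>0$ and $l_0\ge 0$ such that $\frac{1}{C_0(1+|a|)^{l_0}}\le|\operatorname{Res}_a(U)|\le C_0(1+|a|)^{l_0}$ for all $a\in\mathcal A$; 5. there are $\varepsilon>0$ and $l\in\mathbb R$, where $\varepsilon$ is small in the sense that $2\varepsilon<\eta$ and $2\varepsilon\le|a-b|$ for all distinct $a,b\in\mathcal A$, such that $$\sup\Big\{\frac{|U(z)|}{(1+|z|)^{l}} : z\in\mathbb C_\eta,\ d(z,\mathcal A)\ge\varepsilon\Big\}<\infty .$$ Let $\Omega$ be the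 set of continuous even functions $\omega:\mathbb R\to[1,+\infty)$ such that $\lim_{x\to\pm\infty}e^{-\varepsilon|x|}\omega(x)=0$ for every $\varepsilon>0$ and, for every $\delta>0$, $$\sup\Big\{\Big|\int_0^{+\infty}\omega(x)e^{-zx}\,dx\Big| : z\in\mathbb C,\ \operatorname{Re}(z)>0,\ |z|\ge\delta\Big\}<\infty .$$ For $U\in\mathcal L_\eta$ let $T_U$ be the tempered distribution whose Fourier transform is the restriction of $U$ to the imaginary axis, so that for $f\in C_c^\infty(\mathbb R)$ (complex-valued), with $\widehat f(z)=\int_{\mathbb R}f(x)e^{-zx}\,dx$, $$T_U\star f(x)=\frac1{2\pi}\int_{\mathbb R}e^{i\xi x}\,U(i\xi)\,\widehat f(i\xi)\,d\xi .$$ Let $L^2_\omega(\mathbb R)$ be the space of (classes of) functions $g$ with $\|g\|^2=\int_{\mathbb R}|g(x)|^2\omega(x)\,dx<\infty$. **Proposition.** Let $\eta>0$, $U\in\mathcal L_\eta$ and $\omega\in\Omega$. Assume that $f\mapsto T_U\star f$ is continuous from $C_c^\infty(\mathbb R)$, with its usual inductive limit topology, to $L^2_\omega(\mathbb R)$. Then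 $\omega$ does not grow faster than any polynomial: there is $l\in\mathbb N$ such that $\liminf_{x\to+\infty}\omega(x)/x^l=0$. -/

import Mathlib

open MeasureTheory Filter Topology
open scoped ENNReal Distributions

/-- The open vertical strip `{z : |Re z| < η}`. -/
def verticalStrip (η : ℝ) : Set ℂ := {z | |z.re| < η}

/-- The poles of `U` in the strip `|Re z| < η`. -/
def stripPoles (η : ℝ) (U : ℂ → ℂ) : Set ℂ :=
  {z | z ∈ verticalStrip η ∧ meromorphicOrderAt U z < 0}

/-- The residue of `U` at `a`, when `a` is at most a simple pole of `U`, is `r`. -/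
def HasSimpleResidue (U : ℂ → ℂ) (a r : ℂ) : Prop :=
  Tendsto (fun z => (z - a) * U z) (𝓝[≠] a) (𝓝 r)

/-- The class `𝓛_η` of meromorphic functions on the strip `|Re z| < η`. Only the values of `U` on
the strip matter, and its (junk) values at the poles play no role. -/
structure InClassL (η : ℝ) (U : ℂ → ℂ) : Prop where
  meromorphic : MeromorphicOn U (verticalStrip η)
  holomorphic_off_poles : ∀ z ∈ verticalStrip η, z ∉ stripPoles η U → AnalyticAt ℂ U z
  simple : ∀ a ∈ stripPoles η U, meromorphicOrderAt U a = -1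
  infinite : (stripPoles η U).Infinite
  separated : ∃ δ : ℝ, 0 < δ ∧
    ∀ a ∈ stripPoles η U, ∀ b ∈ stripPoles η U, a ≠ b → δ ≤ dist a b
  poles_lower : ∃ l₁ : ℝ, 0 < l₁ ∧ ∃ s : ℝ, s < 0 ∧
    IsLUB ((fun a : ℂ => (1 + ‖a‖) ^ l₁ * a.re) '' stripPoles η U) s
  poles_upper : ∃ l₂ : ℝ, 0 < l₂ ∧
    IsLUB ((fun a : ℂ => (1 + ‖a‖) ^ l₂ * a.re) '' stripPoles η U) 0
  residues : ∃ C₀ l₀ : ℝ, 0 < C₀ ∧ 0 ≤ l₀ ∧ ∀ a ∈ stripPoles η U, ∃ r : ℂ,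
    HasSimpleResidue U a r ∧
      1 / (C₀ * (1 + ‖a‖) ^ l₀) ≤ ‖r‖ ∧ ‖r‖ ≤ C₀ * (1 + ‖a‖) ^ l₀
  /-- Polynomial growth outside the `ε`-neighbourhood of the poles, where `ε` is small: `2 ε` is
  less than the half-width of the strip and at most the distance of any two distinct poles. -/
  growth : ∃ ε l C : ℝ, 0 < ε ∧ 2 * ε < η ∧
    (∀ a ∈ stripPoles η U, ∀ b ∈ stripPoles η U, a ≠ b → 2 * ε ≤ dist a b) ∧
    ∀ z ∈ verticalStrip η, ε ≤ Metric.infDist z (stripPoles η U) →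
      ‖U z‖ / (1 + ‖z‖) ^ l ≤ C

/-- The class `Ω` of weights. -/
structure InOmega (ω : ℝ → ℝ) : Prop where
  continuous : Continuous ω
  one_le : ∀ x, 1 ≤ ω x
  even : ∀ x, ω (-x) = ω x
  strictly_subexp_top : ∀ ε : ℝ, 0 < ε →
    Tendsto (fun x => Real.exp (-ε * |x|) * ω x) atTop (𝓝 0)
  strictly_subexp_bot : ∀ ε : ℝ, 0 < ε →
    Tendsto (fun x => Real.exp (-ε * |x|) * ω x) atBot (𝓝 0)
  laplace_bounded : ∀ δ : ℝ, 0 < δ → ∃ C : ℝ, ∀ z : ℂ, 0 < z.re → δ ≤ ‖z‖ →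
    ‖∫ x in Set.Ioi (0 : ℝ), (ω x : ℂ) * Complex.exp (-z * (x : ℂ))‖ ≤ C

/-- The Fourier-Laplace transform `∫ f(x) e^{-zx} dx`. -/
noncomputable def fourierLaplace (f : ℝ → ℂ) (z : ℂ) : ℂ :=
  ∫ x : ℝ, f x * Complex.exp (-z * (x : ℂ))

/-- The convolution `T_U ⋆ f`, where `T_U` is the tempered distribution whose Fourier transform is
the restriction of `U` to the imaginary axis:
`(T_U ⋆ f)(x) = (1 / 2π) ∫ e^{iξx} U(iξ) f̂(iξ) dξ`. -/
noncomputable def convT (U : ℂ → ℂ) (f : ℝ → ℂ) (x : ℝ) : ℂ :=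
  (1 / (2 * (Real.pi : ℂ))) * ∫ ξ : ℝ, Complex.exp (Complex.I * (ξ : ℂ) * (x : ℂ)) *
    U (Complex.I * (ξ : ℂ)) * fourierLaplace f (Complex.I * (ξ : ℂ))

/-- The measure `ω(x) dx`. -/
noncomputable def weightMeasure (ω : ℝ → ℝ) : Measure ℝ :=
  volume.withDensity fun x => ENNReal.ofReal (ω x)

/-- `f ↦ T_U ⋆ f` is a continuous linear operator from `C_c^∞(ℝ)`, with its usual inductive limit
topology, to `L²_ω(ℝ)`, the space of `g` with `∫ |g|² ω < ∞` and its usual norm. -/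
def ConvContinuous (U : ℂ → ℂ) (ω : ℝ → ℝ) : Prop :=
  ∃ P : 𝓓((⊤ : TopologicalSpace.Opens ℝ), ℂ) →L[ℂ] Lp ℂ 2 (weightMeasure ω),
    ∀ f : 𝓓((⊤ : TopologicalSpace.Opens ℝ), ℂ), (P f : ℝ → ℂ) =ᵐ[volume] convT U f

/-- `ω` does not grow faster than any polynomial: `liminf_{x → +∞} ω(x) / x ^ l = 0` for some
`l : ℕ`. The lower limit is taken in `[0, ∞]`. -/
def NotFasterThanPolynomials (ω : ℝ → ℝ) : Prop :=
  ∃ l : ℕ, liminf (fun x : ℝ => ENNReal.ofReal (ω x / x ^ l)) atTop = 0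

/-! Suppose that `ω` outgrows every polynomial. Then elements of `L²_ω` have moments of all orders,
so the Fourier transform of `T_U ⋆ f`, which is `U f̂` on the imaginary axis, has bounded
derivatives of all orders. Poles of `U` polynomially close to the axis contradict this
quantitatively. Take a pole `a`, put `T = 1 + |a|`, and test with `f(x) = e^{i Im(a) x} φ(x)`, where
`φ` is a fixed smooth density. Continuity of the operator gives `‖T_U ⋆ f‖ ≤ A T^m` with `m`
depending on `φ` only (`exists_norm_modulate_le`), so the `k`-th derivative of `U f̂` on the axis is
`O(T^{2m})` for each `k` (`norm_iteratedDeriv_mul_fourierLaplace_le`). Near `a`, however, `U f̂` is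
a simple pole with residue at least of order `T^{-L₀}` plus a holomorphic remainder of size
`O(T^L)`. Its `k`-th derivative at `i Im a` is therefore at least of order `T^{-L₀} |Re a|^{-(k+1)}
- O(T^L)` (`le_norm_iteratedDeriv_mul_fourierLaplace`). There are arbitrarily large poles with `|Re
a| ≤ T^{-l₂}` (`InClassL.exists_pole_near_axis`), so a `k` with `l₂ (k+1) > L₀ + L + 2m` makes the
two bounds incompatible for large `T`. -/

/-! ### Modulated test functions -/

lemma iteratedDeriv_cexp_I_mul (t : ℝ) (n : ℕ) :
    iteratedDeriv n (fun x : ℝ => Complex.exp (Complex.I * t * x)) =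
      fun x : ℝ => (Complex.I * t) ^ n * Complex.exp (Complex.I * t * x) := by
  induction n with
  | zero => ext x; simp
  | succ n ih =>
    ext x
    rw [iteratedDeriv_succ, ih]
    have h : HasDerivAt (fun x : ℝ => Complex.exp (Complex.I * t * x))
        (Complex.exp (Complex.I * t * x) * (Complex.I * t * 1)) x :=
      (((Complex.ofRealCLM.hasDerivAt (x := x)).const_mul (Complex.I * (t : ℂ)))).cexp
    rw [(h.const_mul _).deriv]
    ring

lemma norm_cexp_I_mul (t x : ℝ) : ‖Complex.exp (Complex.I * t * x)‖ = 1 := by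
  rw [show Complex.I * t * x = ((t * x : ℝ) : ℂ) * Complex.I by push_cast; ring,
    Complex.norm_exp_ofReal_mul_I]

lemma contDiff_cexp_I_mul (t : ℝ) {n : WithTop ℕ∞} :
    ContDiff ℝ n (fun x : ℝ => Complex.exp (Complex.I * t * x)) := by
  have : ContDiff ℝ n (fun x : ℝ => (x : ℂ)) := Complex.ofRealCLM.contDiff
  fun_prop

/-- The function `e^{itx} φ(x)`. -/
noncomputable def modulate (φ : ℝ → ℝ) (t x : ℝ) : ℂ :=
  Complex.exp (Complex.I * t * x) * (φ x : ℂ)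

lemma norm_modulate (φ : ℝ → ℝ) (t x : ℝ) : ‖modulate φ t x‖ = |φ x| := by
  rw [modulate, norm_mul, norm_cexp_I_mul, one_mul, Complex.norm_real, Real.norm_eq_abs]

lemma contDiff_ofReal_comp {φ : ℝ → ℝ} {n : WithTop ℕ∞} (hφ : ContDiff ℝ n φ) :
    ContDiff ℝ n fun x => (φ x : ℂ) :=
  Complex.ofRealCLM.contDiff.comp hφ

lemma contDiff_modulate {φ : ℝ → ℝ} {n : WithTop ℕ∞} (hφ : ContDiff ℝ n φ) (t : ℝ) :
    ContDiff ℝ n (modulate φ t) :=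
  (contDiff_cexp_I_mul t).mul (contDiff_ofReal_comp hφ)

/-- The function `e^{itx} φ(x)` as a smooth function supported in `K`. -/
noncomputable def modulateOn {K : TopologicalSpace.Compacts ℝ} {φ : ℝ → ℝ}
    (hφ : ContDiff ℝ ((⊤ : ℕ∞) : WithTop ℕ∞) φ) (hK : Function.support φ ⊆ K) (t : ℝ) :
    𝓓_{K}(ℝ, ℂ) :=
  ContDiffMapSupportedIn.of_support_subset (contDiff_modulate hφ t) (by
    intro x hx
    apply hK
    rw [Function.mem_support, ← norm_ne_zero_iff, norm_modulate] at hx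
    simpa using hx)

/-- By the Leibniz rule, each derivative falling on the exponential costs one factor `|t|`, and the
derivatives of `φ` are bounded by compactness of the support. -/
lemma seminorm_modulateOn_le {K : TopologicalSpace.Compacts ℝ} {φ : ℝ → ℝ}
    (hφ : ContDiff ℝ ((⊤ : ℕ∞) : WithTop ℕ∞) φ) (hK : Function.support φ ⊆ K) (i : ℕ) :
    ∃ C : ℝ, 0 ≤ C ∧ ∀ t : ℝ,
      ContDiffMapSupportedIn.seminorm ℂ ℝ ℂ ⊤ K i (modulateOn hφ hK t) ≤ C * (1 + |t|) ^ i := by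
  have hcs : HasCompactSupport fun x => (φ x : ℂ) :=
    HasCompactSupport.intro K.isCompact fun x hx => by
      have := fun h => hx (hK h)
      simpa using this
  have hb : ∀ j : ℕ, ∃ B : ℝ, ∀ x, ‖iteratedFDeriv ℝ j (fun x => (φ x : ℂ)) x‖ ≤ B := fun j =>
    Continuous.bounded_above_of_compact_support
      ((contDiff_ofReal_comp hφ).continuous_iteratedFDeriv (m := j) (mod_cast le_top))
      (hcs.iteratedFDeriv j)
  choose B hB using hb
  have hB0 : ∀ j, 0 ≤ B j := fun j => (norm_nonneg _).trans (hB j 0)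
  refine ⟨∑ j ∈ Finset.range (i + 1), (i.choose j : ℝ) * B (i - j),
    Finset.sum_nonneg fun j _ => mul_nonneg (by positivity) (hB0 _), fun t => ?_⟩
  rw [ContDiffMapSupportedIn.seminorm_top_le_iff ℂ
    (mul_nonneg (Finset.sum_nonneg fun j _ => mul_nonneg (by positivity) (hB0 _))
      (by positivity))]
  intro x _
  refine (norm_iteratedFDeriv_mul_le (contDiff_cexp_I_mul t (n := ((⊤ : ℕ∞) : WithTop ℕ∞)))
    (contDiff_ofReal_comp hφ) x (mod_cast le_top)).trans ?_
  rw [Finset.sum_mul]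
  refine Finset.sum_le_sum fun j hj => ?_
  rw [norm_iteratedFDeriv_eq_norm_iteratedDeriv, iteratedDeriv_cexp_I_mul, norm_mul,
    norm_cexp_I_mul, norm_pow, norm_mul, Complex.norm_I, one_mul, mul_one, Complex.norm_real,
    Real.norm_eq_abs]
  have h1 : |t| ^ j ≤ (1 + |t|) ^ i :=
    (pow_le_pow_left₀ (abs_nonneg t) (by linarith) j).trans
      (pow_le_pow_right₀ (by linarith [abs_nonneg t]) (by simpa [Nat.lt_succ_iff] using hj))
  calc (i.choose j : ℝ) * |t| ^ j * ‖iteratedFDeriv ℝ (i - j) (fun x => (φ x : ℂ)) x‖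
      ≤ (i.choose j : ℝ) * (1 + |t|) ^ i * B (i - j) := by
        gcongr
        exact hB _ _
    _ = _ := by ring

/-- A continuous linear map on test functions grows at most polynomially under modulation. -/
lemma exists_norm_modulate_le {E : Type*} [NormedAddCommGroup E] [NormedSpace ℂ E]
    (P : 𝓓((⊤ : TopologicalSpace.Opens ℝ), ℂ) →L[ℂ] E)
    {K : TopologicalSpace.Compacts ℝ} {φ : ℝ → ℝ}
    (hφ : ContDiff ℝ ((⊤ : ℕ∞) : WithTop ℕ∞) φ) (hK : Function.support φ ⊆ K) :
    ∃ (C : ℝ) (m : ℕ), 0 ≤ C ∧ ∀ t : ℝ,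
      ‖P (TestFunction.ofSupportedIn (by simp) (modulateOn hφ hK t))‖ ≤ C * (1 + |t|) ^ m := by
  let Q : 𝓓_{K}(ℝ, ℂ) →L[ℂ] E :=
    P.comp (TestFunction.ofSupportedInCLM ℂ (K := K) (Ω := ⊤) (by simp))
  let q : Seminorm ℂ 𝓓_{K}(ℝ, ℂ) := (normSeminorm ℂ E).comp (Q : 𝓓_{K}(ℝ, ℂ) →ₗ[ℂ] E)
  have hq : Continuous q := continuous_norm.comp Q.continuous
  obtain ⟨s, C, -, hs⟩ := Seminorm.bound_of_continuous
    (ContDiffMapSupportedIn.withSeminorms ℂ ℝ ℂ ⊤ K) q hq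
  choose B hB0 hB using fun i => seminorm_modulateOn_le hφ hK i
  -- The exponent is the highest order among the finitely many seminorms that control `P` on
  -- functions supported in `K`.
  refine ⟨C * ∑ i ∈ s, B i, s.sup id, mul_nonneg C.2 (Finset.sum_nonneg fun i _ => hB0 i),
    fun t => ?_⟩
  refine (hs (modulateOn hφ hK t)).trans ?_
  rw [smul_apply, NNReal.smul_def, smul_eq_mul, mul_assoc]
  refine mul_le_mul_of_nonneg_left ?_ C.2
  refine Seminorm.finset_sup_apply_le
    (mul_nonneg (Finset.sum_nonneg fun i _ => hB0 i) (by positivity)) fun i hi => ?_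
  refine (hB i t).trans ?_
  gcongr
  · exact Finset.sum_nonneg fun i _ => hB0 i
  · exact Finset.single_le_sum (f := B) (fun i _ => hB0 i) hi
  · linarith [abs_nonneg t]
  · exact Finset.le_sup (f := id) hi

/-! ### Weights and moments -/

lemma exists_lower_bound_of_not_notFasterThanPolynomials {ω : ℝ → ℝ} (hω : InOmega ω)
    (h : ¬ NotFasterThanPolynomials ω) (l : ℕ) :
    ∃ c : ℝ, 0 < c ∧ ∀ x, c * (1 + x ^ 2) ^ l ≤ ω x := by
  have hl : 0 < liminf (fun x : ℝ => ENNReal.ofReal (ω x / x ^ (2 * l))) atTop :=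
    pos_iff_ne_zero.2 fun h0 => h ⟨2 * l, h0⟩
  obtain ⟨b, hb0, hb⟩ := ENNReal.lt_iff_exists_nnreal_btwn.1 hl
  obtain ⟨X, hX⟩ := eventually_atTop.1 (eventually_lt_of_lt_liminf hb)
  have hb0' : (0 : ℝ) < b := by exact_mod_cast hb0
  set Y := max X 1
  have hY1 : 1 ≤ Y := le_max_right _ _
  -- The first entry serves `x ≥ Y`, where `1 + x² ≤ 2x²`; the second serves `0 ≤ x ≤ Y`, where `ω ≥
  -- 1` suffices. Evenness covers negative `x`.
  refine ⟨min ((b : ℝ) / 2 ^ l) (1 / (1 + Y ^ 2) ^ l), by positivity, ?_⟩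
  have key : ∀ x, 0 ≤ x → min ((b : ℝ) / 2 ^ l) (1 / (1 + Y ^ 2) ^ l) * (1 + x ^ 2) ^ l ≤ ω x := by
    intro x hx
    rcases le_total x Y with hxY | hxY
    · calc _ ≤ 1 / (1 + Y ^ 2) ^ l * (1 + Y ^ 2) ^ l := by
            gcongr
            exact min_le_right _ _
        _ = 1 := by field_simp
        _ ≤ ω x := hω.one_le x
    · have hx1 : 1 ≤ x := hY1.trans hxY
      have h1 := hX x ((le_max_left _ _).trans hxY)
      rw [← ENNReal.ofReal_coe_nnreal, ENNReal.ofReal_lt_ofReal_iff', lt_div_iff₀ (by positivity)]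
        at h1
      calc _ ≤ (b / 2 ^ l : ℝ) * (2 * x ^ 2) ^ l := by
            gcongr
            · exact min_le_left _ _
            · nlinarith
        _ = b * x ^ (2 * l) := by
            rw [mul_pow, pow_mul]
            field_simp
        _ ≤ ω x := h1.1.le
  intro x
  rcases le_total 0 x with hx | hx
  · exact key x hx
  · simpa [hω.even] using key (-x) (by linarith)

lemma absolutelyContinuous_weightMeasure {ω : ℝ → ℝ} (hω : InOmega ω) :
    volume ≪ weightMeasure ω := by
  refine withDensity_absolutelyContinuous' hω.continuous.measurable.ennreal_ofReal.aemeasurable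
    (Eventually.of_forall fun x => ?_)
  have := hω.one_le x
  simp only [ne_eq, ENNReal.ofReal_eq_zero, not_le]
  linarith

lemma integral_norm_sq_mul_weight {ω : ℝ → ℝ} (hω : InOmega ω) (F : Lp ℂ 2 (weightMeasure ω)) :
    Integrable (fun x => ω x * ‖F x‖ ^ 2) ∧ ∫ x, ω x * ‖F x‖ ^ 2 = ‖F‖ ^ 2 := by
  have hm : Measurable fun x => (ω x).toNNReal := hω.continuous.measurable.real_toNNReal
  have hω0 : ∀ x, 0 ≤ ω x := fun x => zero_le_one.trans (hω.one_le x)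
  have hF : MemLp F 2 (weightMeasure ω) := Lp.memLp F
  have hint : Integrable (fun x => ‖F x‖ ^ 2) (weightMeasure ω) :=
    (memLp_two_iff_integrable_sq_norm hF.1).1 hF
  have hnorm : ‖F‖ ^ 2 = ∫ x, ‖F x‖ ^ 2 ∂(weightMeasure ω) := by
    have h1 := MemLp.eLpNorm_eq_integral_rpow_norm (p := 2) (by norm_num) (by norm_num) hF
    rw [Lp.norm_def, h1, ENNReal.toReal_ofReal (by positivity)]
    have h0 : 0 ≤ ∫ x, ‖F x‖ ^ 2 ∂(weightMeasure ω) := integral_nonneg fun x => by positivity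
    simp only [ENNReal.toReal_ofNat, Real.rpow_ofNat]
    rw [← Real.rpow_natCast, ← Real.rpow_mul h0]
    norm_num
  have h2 := (integrable_withDensity_iff_integrable_smul₀ (μ := volume) hm.aemeasurable).1 hint
  refine ⟨h2.congr (Eventually.of_forall fun x => ?_), ?_⟩
  · simp [NNReal.smul_def, Real.coe_toNNReal _ (hω0 x)]
  · refine Eq.trans ?_ (hnorm.trans (integral_withDensity_eq_integral_smul hm _)).symm
    refine integral_congr_ae (Eventually.of_forall fun x => ?_)
    simp [NNReal.smul_def, Real.coe_toNNReal _ (hω0 x)]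

/-- A lower polynomial bound for the weight controls the moments of `L²_ω` functions. -/
lemma integrable_pow_mul_norm {ω : ℝ → ℝ} (hω : InOmega ω) {c : ℝ} (hc : 0 < c) {k : ℕ}
    (hck : ∀ x, c * (1 + x ^ 2) ^ (k + 1) ≤ ω x) (F : Lp ℂ 2 (weightMeasure ω)) :
    Integrable (fun x => |x| ^ k * ‖F x‖) ∧
      ∫ x, |x| ^ k * ‖F x‖ ≤ ‖F‖ ^ 2 + c⁻¹ * Real.pi := by
  obtain ⟨h1, h2⟩ := integral_norm_sq_mul_weight hω F
  have h3 : Integrable fun x : ℝ => c⁻¹ * (1 + x ^ 2)⁻¹ := integrable_inv_one_add_sq.const_mul _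
  have hle : ∀ x, |x| ^ k * ‖F x‖ ≤ ω x * ‖F x‖ ^ 2 + c⁻¹ * (1 + x ^ 2)⁻¹ := by
    intro x
    have hω0 : 0 < ω x := zero_lt_one.trans_le (hω.one_le x)
    -- A weighted arithmetic-geometric mean inequality. The exponent `k + 1` in the lower bound on
    -- `ω` leaves the integrable factor `(1 + x²)⁻¹`, whose integral is `π`.
    have h4 : |x| ^ k * ‖F x‖ ≤ ω x * ‖F x‖ ^ 2 + (|x| ^ k) ^ 2 / ω x := by
      have h6 : (|x| ^ k) ^ 2 / ω x = ω x * (|x| ^ k / ω x) ^ 2 := by field_simp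
      have h7 : |x| ^ k * ‖F x‖ = ω x * (|x| ^ k / ω x * ‖F x‖) := by field_simp
      rw [h6, h7, ← mul_add]
      gcongr
      nlinarith [sq_nonneg (|x| ^ k / ω x - ‖F x‖), sq_nonneg (|x| ^ k / ω x), sq_nonneg ‖F x‖]
    have h5 : (|x| ^ k) ^ 2 / ω x ≤ c⁻¹ * (1 + x ^ 2)⁻¹ := by
      calc (|x| ^ k) ^ 2 / ω x ≤ (1 + x ^ 2) ^ k / (c * (1 + x ^ 2) ^ (k + 1)) := by
            gcongr
            · rw [← pow_mul, mul_comm k 2, pow_mul, sq_abs]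
              gcongr
              linarith
            · exact hck x
        _ = _ := by
            field_simp
            exact (pow_succ' _ _).symm
    linarith
  have hmeas : AEStronglyMeasurable (fun x => |x| ^ k * ‖F x‖) volume := by
    have := ((Lp.aestronglyMeasurable F).mono_ac (absolutelyContinuous_weightMeasure hω)).norm
    exact (by fun_prop : Continuous fun x : ℝ => |x| ^ k).aestronglyMeasurable.mul this
  refine ⟨(h1.add h3).mono' hmeas (Eventually.of_forall fun x => ?_), ?_⟩
  · rw [Real.norm_eq_abs, abs_of_nonneg (by positivity)]
    exact hle x
  · refine (integral_mono_of_nonneg (Eventually.of_forall fun x => by positivity) (h1.add h3)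
      (Eventually.of_forall hle)).trans_eq ?_
    simp only [Pi.add_apply]
    rw [integral_add h1 h3, h2, integral_const_mul, integral_univ_inv_one_add_sq]

/-! ### The multiplier on the axis as a Fourier transform -/

open scoped FourierTransform

lemma fourierLaplace_eq_fourier (f : ℝ → ℂ) (ξ : ℝ) :
    fourierLaplace f (Complex.I * (2 * Real.pi * ξ : ℝ)) = 𝓕 f ξ := by
  rw [fourierLaplace, Real.fourier_eq']
  refine integral_congr_ae (Eventually.of_forall fun x => ?_)
  simp only [smul_eq_mul]
  rw [mul_comm]
  congr 2
  simp
  ring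

lemma convT_eq_fourierInv (U : ℂ → ℂ) (f : ℝ → ℂ) :
    convT U f = 𝓕⁻ fun ξ : ℝ => U (Complex.I * (2 * Real.pi * ξ : ℝ)) * 𝓕 f ξ := by
  ext x
  rw [convT, Real.fourierInv_eq']
  have h := Measure.integral_comp_mul_left (fun ξ : ℝ => Complex.exp (Complex.I * (ξ : ℂ) * (x : ℂ)) *
    U (Complex.I * (ξ : ℂ)) * fourierLaplace f (Complex.I * (ξ : ℂ))) (2 * Real.pi)
  have h2 : |(2 * Real.pi)⁻¹| = (2 * Real.pi)⁻¹ := abs_of_pos (by positivity)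
  rw [h2] at h
  have h3 : (1 / (2 * (Real.pi : ℂ))) = (((2 * Real.pi)⁻¹ : ℝ) : ℂ) := by push_cast; simp
  rw [h3, ← Complex.real_smul, ← h]
  refine integral_congr_ae (Eventually.of_forall fun ξ => ?_)
  simp only [smul_eq_mul]
  rw [fourierLaplace_eq_fourier, mul_assoc]
  congr 2
  simp
  ring

lemma integrable_mul_fourier {V f : ℝ → ℂ} (hV : Continuous V) {C : ℝ} {L : ℕ}
    (hVC : ∀ ξ, ‖V ξ‖ ≤ C * (1 + ‖ξ‖) ^ L)
    (hf : ContDiff ℝ ((⊤ : ℕ∞) : WithTop ℕ∞) f) (hfs : HasCompactSupport f) :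
    (Continuous fun ξ => V ξ * 𝓕 f ξ) ∧ Integrable fun ξ => V ξ * 𝓕 f ξ := by
  set S : SchwartzMap ℝ ℂ := hfs.toSchwartzMap hf
  have hS : (𝓕 S : SchwartzMap ℝ ℂ) = 𝓕 f := by
    ext ξ
    rw [SchwartzMap.fourier_coe]
    rfl
  have hc : Continuous fun ξ => V ξ * 𝓕 f ξ := by
    rw [← hS]
    exact hV.mul (𝓕 S : SchwartzMap ℝ ℂ).continuous
  refine ⟨hc, ?_⟩
  have hi : ∀ k : ℕ, Integrable fun ξ : ℝ => ‖ξ‖ ^ k * ‖(𝓕 S : SchwartzMap ℝ ℂ) ξ‖ := fun k =>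
    (𝓕 S : SchwartzMap ℝ ℂ).integrable_pow_mul volume k
  have hsum := (((hi 0).add (hi L)).const_mul (2 ^ L * C))
  refine hsum.mono' hc.aestronglyMeasurable (Eventually.of_forall fun ξ => ?_)
  have hC : 0 ≤ C := by
    have := (norm_nonneg _).trans (hVC 0)
    simpa using this
  rw [norm_mul, ← hS]
  have h1 : (1 + ‖ξ‖) ^ L ≤ 2 ^ L * (1 + ‖ξ‖ ^ L) := by
    have := add_pow_le (zero_le_one (α := ℝ)) (norm_nonneg ξ) L
    refine this.trans ?_
    rw [one_pow]
    gcongr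
    · norm_num
    · omega
  calc ‖V ξ‖ * ‖(𝓕 S : SchwartzMap ℝ ℂ) ξ‖
      ≤ C * (2 ^ L * (1 + ‖ξ‖ ^ L)) * ‖(𝓕 S : SchwartzMap ℝ ℂ) ξ‖ := by
        gcongr
        exact (hVC ξ).trans (by gcongr)
    _ = _ := by simp; ring

/-- Moments of the inverse Fourier transform of `h` control the derivatives of `h`. -/
lemma norm_iteratedDeriv_le_of_fourierInv {h g : ℝ → ℂ} (hc : Continuous h) (hi : Integrable h)
    (hg : g =ᵐ[volume] 𝓕⁻ h) {k : ℕ} (hk : ∀ n ≤ k, Integrable fun x => |x| ^ n * ‖g x‖)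
    (ξ : ℝ) :
    ‖iteratedDeriv k h ξ‖ ≤ (2 * Real.pi) ^ k * ∫ x, |x| ^ k * ‖g x‖ := by
  have hcont : Continuous (𝓕⁻ h) := by
    have h1 : (𝓕⁻ h : ℝ → ℂ) = fun x => 𝓕 h (-x) := by
      ext x
      rw [Real.fourierInv_eq_fourier_neg]
    rw [h1]
    exact (VectorFourier.fourierIntegral_continuous Real.continuous_fourierChar
      (by exact continuous_inner) hi).comp continuous_neg
  have hk' : ∀ n : ℕ, n ≤ (k : ℕ∞) → Integrable fun x : ℝ => x ^ n • (𝓕⁻ h : ℝ → ℂ) x := by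
    intro n hn
    refine ((hk n (by exact_mod_cast hn))).mono' (by fun_prop) ?_
    filter_upwards [hg] with x hx
    rw [norm_smul, norm_pow, Real.norm_eq_abs, hx]
  have h0 : Integrable (𝓕⁻ h : ℝ → ℂ) := by simpa using hk' 0 (by simp)
  -- Inversion needs `𝓕 h` integrable; it is the reflection of `𝓕⁻ h`, whose integrability is the
  -- moment of order `0`.
  have hh : 𝓕 (𝓕⁻ h : ℝ → ℂ) = h := by
    refine Continuous.fourier_fourierInv_eq hc hi ?_
    have h2 : (𝓕 h : ℝ → ℂ) = fun x => (𝓕⁻ h : ℝ → ℂ) (-x) := by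
      ext x
      rw [Real.fourierInv_eq_fourier_neg, neg_neg]
    rw [h2]
    exact h0.comp_neg
  rw [← hh, Real.iteratedDeriv_fourier (N := k) hk' le_rfl]
  refine (VectorFourier.norm_fourierIntegral_le_integral_norm _ _ _ _ _).trans_eq ?_
  rw [← integral_const_mul]
  refine integral_congr_ae ?_
  filter_upwards [hg] with x hx
  simp [hx, abs_of_pos Real.pi_pos]
  ring

/-! ### Derivatives near a simple pole -/

section ComplexAnalysis

lemma iteratedDeriv_comp_const_mul_ofReal {F : ℂ → ℂ} {S : Set ℂ} (hS : IsOpen S)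
    (hF : DifferentiableOn ℂ F S) (c : ℂ) (k : ℕ) {ξ : ℝ} (hξ : c * ξ ∈ S) :
    iteratedDeriv k (fun ξ : ℝ => F (c * ξ)) ξ = c ^ k * iteratedDeriv k F (c * ξ) := by
  induction k generalizing ξ with
  | zero => simp
  | succ k ih =>
    have hcont : Continuous fun ξ : ℝ => c * (ξ : ℂ) := by fun_prop
    have hev : iteratedDeriv k (fun ξ : ℝ => F (c * ξ)) =ᶠ[𝓝 ξ]
        fun ξ : ℝ => c ^ k * iteratedDeriv k F (c * ξ) := by
      filter_upwards [(hS.preimage hcont).mem_nhds hξ] with x hx using ih hx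
    have han : AnalyticAt ℂ (iteratedDeriv k F) (c * ξ) := by
      rw [iteratedDeriv_eq_iterate]
      exact (hF.analyticAt (hS.mem_nhds hξ)).iterated_deriv k
    have hin : HasDerivAt (fun ξ : ℝ => c * (ξ : ℂ)) (c * 1) ξ :=
      (Complex.ofRealCLM.hasDerivAt (x := ξ)).const_mul c
    have hd := (han.differentiableAt.hasDerivAt.comp ξ hin).const_mul (c ^ k)
    rw [iteratedDeriv_succ, hev.deriv_eq]
    refine hd.deriv.trans ?_
    rw [iteratedDeriv_succ (f := F)]
    ring

/-- Cauchy's estimates for a function with a simple pole near the center. -/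
lemma le_norm_iteratedDeriv_div_sub {G : ℂ → ℂ} {S : Set ℂ} (hS : IsOpen S)
    (hG : DifferentiableOn ℂ G S) {a z₀ : ℂ} {ε B : ℝ} (hε : 0 < ε)
    (hsub : Metric.closedBall a ε ⊆ S) (hB : ∀ z ∈ Metric.closedBall a ε, ‖G z‖ ≤ B)
    (hz₀ : z₀ ≠ a) (hdist : dist z₀ a ≤ ε / 2) (k : ℕ) :
    k.factorial * (‖G a‖ / dist z₀ a ^ (k + 1) - 2 * B / ε / (ε / 2) ^ k) ≤
      ‖iteratedDeriv k (fun z => G z / (z - a)) z₀‖ := by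
  have haS : S ∈ 𝓝 a := hS.mem_nhds (hsub (Metric.mem_closedBall_self hε.le))
  have hW : DifferentiableOn ℂ (dslope G a) S := (Complex.differentiableOn_dslope haS).2 hG
  -- By the maximum principle, the difference quotient need only be bounded on the circle of radius
  -- `ε`, where its denominator has modulus `ε`.
  have hWB : ∀ z ∈ Metric.closedBall a ε, ‖dslope G a z‖ ≤ 2 * B / ε := by
    intro z hz
    refine Complex.norm_le_of_forall_mem_frontier_norm_le Metric.isBounded_ball
      ((hW.mono hsub).diffContOnCl_ball subset_rfl) (fun w hw => ?_)
      (by rwa [closure_ball _ hε.ne'])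
    rw [frontier_ball _ hε.ne', mem_sphere_iff_norm] at hw
    have hwa : w ≠ a := by
      rintro rfl
      simp at hw
      exact hε.ne hw
    rw [dslope_of_ne _ hwa, slope_def_field, norm_div, hw]
    gcongr
    refine (norm_sub_le _ _).trans ?_
    have h1 := hB w (by rw [mem_closedBall_iff_norm, hw])
    have h2 := hB a (Metric.mem_closedBall_self hε.le)
    linarith
  have hz₀S : z₀ ∈ S := hsub (by rw [Metric.mem_closedBall]; linarith)
  have hball : Metric.closedBall z₀ (ε / 2) ⊆ Metric.closedBall a ε :=
    Metric.closedBall_subset_closedBall' (by linarith)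
  have hWk : ‖iteratedDeriv k (dslope G a) z₀‖ ≤ k.factorial * (2 * B / ε) / (ε / 2) ^ k :=
    Complex.norm_iteratedDeriv_le_of_forall_mem_sphere_norm_le k (by positivity)
      ((hW.mono (hball.trans hsub)).diffContOnCl_ball subset_rfl)
      fun z hz => hWB z (hball (Metric.sphere_subset_closedBall hz))
  -- Splitting into the polar part `G a / (z - a)`, differentiated explicitly, and the holomorphic
  -- part `dslope G a`, handled by Cauchy's estimate on radius `ε / 2`.
  have hev : (fun z => G z / (z - a)) =ᶠ[𝓝 z₀]
      (fun z => G a * (z - a)⁻¹) + dslope G a := by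
    filter_upwards [isOpen_ne.mem_nhds hz₀] with z hz
    have : z - a ≠ 0 := sub_ne_zero.2 hz
    rw [Pi.add_apply, dslope_of_ne _ hz, slope_def_field]
    field_simp
    ring
  have hsub0 : z₀ - a ≠ 0 := sub_ne_zero.2 hz₀
  have hpole : iteratedDeriv k (fun z => G a * (z - a)⁻¹) z₀ =
      G a * ((-1) ^ k * k.factorial * (z₀ - a) ^ (-1 - k : ℤ)) := by
    rw [iteratedDeriv_const_mul_field, iteratedDeriv_eq_iterate]
    have := congrFun (iter_deriv_inv_linear_sub (𝕜 := ℂ) k 1 a) z₀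
    simp only [one_mul, one_pow, mul_one] at this
    rw [this]
  have hpn : ‖G a * ((-1) ^ k * k.factorial * (z₀ - a) ^ (-1 - k : ℤ))‖ =
      k.factorial * (‖G a‖ / dist z₀ a ^ (k + 1)) := by
    rw [show (-1 - k : ℤ) = -((k + 1 : ℕ) : ℤ) by push_cast; ring, zpow_neg, zpow_natCast]
    simp only [norm_mul, norm_pow, norm_neg, norm_one, one_pow, one_mul, norm_inv,
      Complex.norm_natCast, dist_eq_norm]
    ring
  have h1 : ContDiffAt ℂ k (fun z => G a * (z - a)⁻¹) z₀ :=
    contDiffAt_const.mul ((contDiffAt_id.sub contDiffAt_const).inv hsub0)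
  have h2 : ContDiffAt ℂ k (dslope G a) z₀ :=
    (hW.analyticAt (hS.mem_nhds hz₀S)).contDiffAt
  rw [hev.iteratedDeriv_eq, iteratedDeriv_add h1 h2, hpole]
  have h3 := norm_sub_le_norm_add (G a * ((-1) ^ k * k.factorial * (z₀ - a) ^ (-1 - k : ℤ)))
    (iteratedDeriv k (dslope G a) z₀)
  rw [hpn] at h3
  calc _ = k.factorial * (‖G a‖ / dist z₀ a ^ (k + 1)) -
        k.factorial * (2 * B / ε) / (ε / 2) ^ k := by ring
    _ ≤ _ := by linarith

end ComplexAnalysis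

/-! ### Fourier-Laplace transforms of modulated densities -/

section FourierLaplace

lemma differentiable_fourierLaplace {f : ℝ → ℂ} (hf : Continuous f) (hfs : HasCompactSupport f) :
    Differentiable ℂ (fourierLaplace f) := by
  intro z₀
  obtain ⟨R, hR⟩ := hfs.isCompact.isBounded.exists_norm_le
  have hR' : ∀ x, f x ≠ 0 → |x| ≤ R := fun x hx => hR x (subset_tsupport f hx)
  have hint : ∀ z : ℂ, Integrable fun x : ℝ => f x * Complex.exp (-z * (x : ℂ)) := fun z =>
    Continuous.integrable_of_hasCompactSupport (by fun_prop) hfs.mul_right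
  have hbint : Integrable fun x : ℝ => ‖f x‖ * (R * Real.exp ((‖z₀‖ + 1) * R)) :=
    ((hf.integrable_of_hasCompactSupport hfs).norm).mul_const _
  have hR0 : ∀ x, f x ≠ 0 → 0 ≤ R := fun x hx => (abs_nonneg x).trans (hR' x hx)
  have := hasDerivAt_integral_of_dominated_loc_of_deriv_le (μ := volume) (𝕜 := ℂ) (x₀ := z₀)
    (F := fun z (x : ℝ) => f x * Complex.exp (-z * (x : ℂ)))
    (F' := fun z (x : ℝ) => f x * (Complex.exp (-z * (x : ℂ)) * (-x)))
    (bound := fun x => ‖f x‖ * (R * Real.exp ((‖z₀‖ + 1) * R)))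
    (Metric.ball_mem_nhds z₀ one_pos)
    (Eventually.of_forall fun z => (hint z).1) (hint z₀)
    (by fun_prop : Continuous _).aestronglyMeasurable
    (Eventually.of_forall fun x z hz => ?_) hbint
    (Eventually.of_forall fun x z hz => ?_)
  · exact this.2.differentiableAt
  · by_cases hx : f x = 0
    · simp [hx]
    · have h0 := hR0 x hx
      rw [norm_mul, norm_mul, norm_neg, Complex.norm_real, Real.norm_eq_abs, Complex.norm_exp]
      rw [mul_comm (Real.exp _)]
      gcongr
      · exact hR' x hx
      · refine (Complex.re_le_norm _).trans ?_
        rw [norm_mul, norm_neg, Complex.norm_real, Real.norm_eq_abs]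
        have h1 : ‖z‖ ≤ ‖z₀‖ + 1 := by
          have := norm_sub_norm_le z z₀
          have h2 := mem_ball_iff_norm.1 hz
          linarith
        have := hR' x hx
        gcongr
  · have h1 : HasDerivAt (fun z : ℂ => -z * (x : ℂ)) (-x) z := by
      simpa using (hasDerivAt_id z).neg.mul_const (x : ℂ)
    exact h1.cexp.const_mul (f x)

lemma norm_fourierLaplace_modulate_le {φ : ℝ → ℝ} (hφ0 : ∀ x, 0 ≤ φ x)
    (hφi : Integrable φ) (hφ1 : ∫ x, φ x = 1) (hφs : ∀ x, φ x ≠ 0 → |x| ≤ 1) (t : ℝ) (z : ℂ) :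
    ‖fourierLaplace (modulate φ t) z‖ ≤ Real.exp |z.re| := by
  have : ∫ x, φ x * Real.exp |z.re| = Real.exp |z.re| := by
    rw [integral_mul_const, hφ1, one_mul]
  rw [← this]
  refine norm_integral_le_of_norm_le (hφi.mul_const _) (Eventually.of_forall fun x => ?_)
  rw [norm_mul, norm_modulate, abs_of_nonneg (hφ0 x), Complex.norm_exp]
  by_cases hx : φ x = 0
  · simp [hx]
  have := hφ0 x
  gcongr
  simp only [Complex.mul_re, Complex.neg_re, Complex.ofReal_re, Complex.neg_im, Complex.ofReal_im,
    mul_zero, sub_zero]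
  refine (le_abs_self _).trans ?_
  rw [abs_mul, abs_neg]
  exact mul_le_of_le_one_right (abs_nonneg _) (hφs x hx)

/-- Modulating at height `Im a` cancels the oscillation of `e^{-ax}`; what remains is the integral
of the positive function `φ(x) e^{-Re(a) x}`. -/
lemma le_norm_fourierLaplace_modulate {φ : ℝ → ℝ} (hφ : Continuous φ) (hφc : HasCompactSupport φ)
    (hφ0 : ∀ x, 0 ≤ φ x) (hφ1 : ∫ x, φ x = 1) (hφs : ∀ x, φ x ≠ 0 → |x| ≤ 1) (a : ℂ) :
    Real.exp (-|a.re|) ≤ ‖fourierLaplace (modulate φ a.im) a‖ := by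
  have h1 : fourierLaplace (modulate φ a.im) a = ((∫ x, φ x * Real.exp (-a.re * x) : ℝ) : ℂ) := by
    rw [fourierLaplace, ← integral_complex_ofReal]
    refine integral_congr_ae (Eventually.of_forall fun x => ?_)
    simp only [modulate, Complex.ofReal_mul, Complex.ofReal_exp, Complex.ofReal_neg]
    rw [mul_right_comm, ← Complex.exp_add, mul_comm]
    congr 2
    linear_combination (x : ℂ) * Complex.re_add_im a
  have h2 : Real.exp (-|a.re|) = ∫ x, φ x * Real.exp (-|a.re|) := by
    rw [integral_mul_const, hφ1, one_mul]
  rw [h1, Complex.norm_real, h2]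
  refine (integral_mono_of_nonneg (Eventually.of_forall fun x => ?_) ?_
    (Eventually.of_forall fun x => ?_)).trans (Real.le_norm_self _)
  · exact mul_nonneg (hφ0 x) (Real.exp_pos _).le
  · exact Continuous.integrable_of_hasCompactSupport (by fun_prop) hφc.mul_right
  · by_cases hx : φ x = 0
    · simp [hx]
    have := hφ0 x
    gcongr
    have h3 : |a.re * x| ≤ |a.re| := by
      rw [abs_mul]
      exact mul_le_of_le_one_right (abs_nonneg _) (hφs x hx)
    have := (abs_le.1 h3).2
    linarith

end FourierLaplace

/-! ### Poles, residues and growth with natural exponents -/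

namespace InClassL

variable {η : ℝ} {U : ℂ → ℂ}

lemma exists_pole (hU : InClassL η U) : (stripPoles η U).Nonempty := hU.infinite.nonempty

lemma exists_le_neg_re (hU : InClassL η U) : ∃ (s : ℝ) (L : ℕ), 0 < s ∧
    ∀ a ∈ stripPoles η U, s ≤ (1 + ‖a‖) ^ L * (-a.re) := by
  obtain ⟨l₁, hl₁, s, hs, hlub⟩ := hU.poles_lower
  refine ⟨-s, ⌈l₁⌉₊, by linarith, fun a ha => ?_⟩
  have h1 : (1 + ‖a‖) ^ l₁ * a.re ≤ s := hlub.1 ⟨a, ha, rfl⟩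
  have hT : 1 ≤ 1 + ‖a‖ := by linarith [norm_nonneg a]
  have hp : 0 < (1 + ‖a‖) ^ l₁ := by positivity
  have hre : 0 < -a.re := by
    by_contra! h
    nlinarith
  have h2 : (1 + ‖a‖) ^ l₁ ≤ (1 + ‖a‖) ^ ⌈l₁⌉₊ := by
    rw [← Real.rpow_natCast]
    exact Real.rpow_le_rpow_of_exponent_le hT (Nat.le_ceil _)
  nlinarith

lemma re_neg (hU : InClassL η U) {a : ℂ} (ha : a ∈ stripPoles η U) : a.re < 0 := by
  obtain ⟨s, L, hs, h⟩ := hU.exists_le_neg_re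
  have h1 := h a ha
  have : 0 < (1 + ‖a‖) ^ L := by positivity
  by_contra! h2
  nlinarith

/-- There are poles of arbitrarily large modulus which are polynomially close to the axis. -/
lemma exists_pole_near_axis (hU : InClassL η U) : ∃ l₂ : ℝ, 0 < l₂ ∧ ∀ M : ℝ,
    ∃ a ∈ stripPoles η U, M ≤ 1 + ‖a‖ ∧ (1 + ‖a‖) ^ l₂ * (-a.re) ≤ 1 := by
  obtain ⟨s, L, hs, h⟩ := hU.exists_le_neg_re
  obtain ⟨l₂, hl₂, hlub⟩ := hU.poles_upper
  refine ⟨l₂, hl₂, fun M => ?_⟩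
  set N := max M 1
  have hN : 1 ≤ N := le_max_right _ _
  -- Poles with `1 + ‖a‖ < N` satisfy `-Re a ≥ s / N ^ L`, so a weighted real part above the second
  -- threshold forces `a` to be far out. The threshold `-1` gives the closeness to the axis. The
  -- supremum `0` supplies a pole beating both.
  have hlt : max (-1) (-(s / N ^ L)) < (0 : ℝ) :=
    max_lt (by norm_num) (by
      have : 0 < s / N ^ L := by positivity
      linarith)
  obtain ⟨_, ⟨a, ha, rfl⟩, hlt', -⟩ := hlub.exists_between hlt
  dsimp only at hlt'
  refine ⟨a, ha, ?_, ?_⟩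
  · by_contra! hlt2
    have h1 := h a ha
    have hneg := hU.re_neg ha
    have h2 : (1 + ‖a‖) ^ L ≤ N ^ L := by
      gcongr
      exact hlt2.le.trans (le_max_left _ _)
    have h3 : s / N ^ L ≤ -a.re := by
      rw [div_le_iff₀ (by positivity)]
      nlinarith
    have h4 : 1 ≤ (1 + ‖a‖) ^ l₂ :=
      Real.one_le_rpow (by linarith [norm_nonneg a]) hl₂.le
    have h5 := (le_max_right _ _).trans_lt hlt'
    nlinarith
  · have h5 := (le_max_left _ _).trans_lt hlt'
    linarith

lemma exists_growth (hU : InClassL η U) : ∃ (ε C : ℝ) (L : ℕ), 0 < ε ∧ 0 ≤ C ∧ 2 * ε < η ∧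
    (∀ a ∈ stripPoles η U, ∀ b ∈ stripPoles η U, a ≠ b → 2 * ε ≤ dist a b) ∧
    ∀ z ∈ verticalStrip η, (∀ a ∈ stripPoles η U, ε ≤ dist z a) →
      ‖U z‖ ≤ C * (1 + ‖z‖) ^ L := by
  obtain ⟨ε, l, C, hε, hεη, hsep, hC⟩ := hU.growth
  refine ⟨ε, |C|, ⌈l⌉₊, hε, abs_nonneg _, hεη, hsep, fun z hz hd => ?_⟩
  -- `Metric.infDist` to the empty set is `0`, so the existence of a pole matters here.
  have h1 := hC z hz ((Metric.le_infDist hU.exists_pole).2 fun {a} ha => hd a ha)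
  rw [div_le_iff₀ (by positivity)] at h1
  refine h1.trans ?_
  have h2 : (1 + ‖z‖) ^ l ≤ (1 + ‖z‖) ^ ⌈l⌉₊ := by
    rw [← Real.rpow_natCast]
    exact Real.rpow_le_rpow_of_exponent_le (by linarith [norm_nonneg z]) (Nat.le_ceil _)
  calc C * (1 + ‖z‖) ^ l ≤ |C| * (1 + ‖z‖) ^ l := by gcongr; exact le_abs_self C
    _ ≤ _ := by gcongr

lemma exists_residue (hU : InClassL η U) : ∃ (c : ℝ) (L : ℕ), 0 < c ∧
    ∀ a ∈ stripPoles η U, ∃ r : ℂ, HasSimpleResidue U a r ∧ c ≤ ‖r‖ * (1 + ‖a‖) ^ L := by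
  obtain ⟨C, l, hC, hl, h⟩ := hU.residues
  refine ⟨1 / C, ⌈l⌉₊, by positivity, fun a ha => ?_⟩
  obtain ⟨r, hr, h1, -⟩ := h a ha
  refine ⟨r, hr, ?_⟩
  have h2 : (1 + ‖a‖) ^ l ≤ (1 + ‖a‖) ^ ⌈l⌉₊ := by
    rw [← Real.rpow_natCast]
    exact Real.rpow_le_rpow_of_exponent_le (by linarith [norm_nonneg a]) (Nat.le_ceil _)
  calc 1 / C = 1 / (C * (1 + ‖a‖) ^ l) * (1 + ‖a‖) ^ l := by field_simp
    _ ≤ _ := by gcongr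

end InClassL

/-! ### Removing a pole, and growth on the axis -/

lemma isOpen_verticalStrip (η : ℝ) : IsOpen (verticalStrip η) :=
  isOpen_lt (by fun_prop) continuous_const

lemma closedBall_subset_ball_inter_verticalStrip {η ε : ℝ} (hε : 0 < ε) {a : ℂ}
    (haη : |a.re| + ε < η) :
    Metric.closedBall a ε ⊆ Metric.ball a (2 * ε) ∩ verticalStrip η := by
  refine Set.subset_inter (Metric.closedBall_subset_ball (by linarith)) fun z hz => ?_
  have h1 := (Complex.abs_re_le_norm (z - a)).trans (mem_closedBall_iff_norm.1 hz)
  have h2 : |z.re| ≤ |(z - a).re| + |a.re| := by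
    simpa using abs_add_le (z - a).re a.re
  simp only [verticalStrip, Set.mem_ofPred_eq]
  linarith

/-- The function `(z - a) U(z)`, with value `r` at `a`. -/
noncomputable def poleRemoved (U : ℂ → ℂ) (a r : ℂ) : ℂ → ℂ :=
  Function.update (fun z => (z - a) * U z) a r

lemma poleRemoved_of_ne (U : ℂ → ℂ) {a z : ℂ} (r : ℂ) (h : z ≠ a) :
    poleRemoved U a r z = (z - a) * U z := by
  simp [poleRemoved, h]

lemma poleRemoved_self (U : ℂ → ℂ) (a r : ℂ) : poleRemoved U a r a = r := by
  simp [poleRemoved]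

namespace InClassL

variable {η : ℝ} {U : ℂ → ℂ}

lemma differentiableOn_poleRemoved (hU : InClassL η U) {ε : ℝ}
    (hsep : ∀ a ∈ stripPoles η U, ∀ b ∈ stripPoles η U, a ≠ b → 2 * ε ≤ dist a b)
    {a r : ℂ} (ha : a ∈ stripPoles η U) (hr : HasSimpleResidue U a r) :
    DifferentiableOn ℂ (poleRemoved U a r) (Metric.ball a (2 * ε) ∩ verticalStrip η) := by
  have hoff : ∀ z ∈ Metric.ball a (2 * ε) ∩ verticalStrip η, z ≠ a →
      DifferentiableAt ℂ (poleRemoved U a r) z := by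
    intro z hz hza
    have hnp : z ∉ stripPoles η U := fun hzp => by
      have := hsep z hzp a ha hza
      have := Metric.mem_ball.1 hz.1
      linarith
    have h1 : DifferentiableAt ℂ (fun z => (z - a) * U z) z :=
      (differentiableAt_id.sub_const a).mul
        (hU.holomorphic_off_poles z hz.2 hnp).differentiableAt
    refine h1.congr_of_eventuallyEq ?_
    filter_upwards [isOpen_ne.mem_nhds hza] with w hw using poleRemoved_of_ne U r hw
  intro z hz
  by_cases hza : z = a
  · subst hza
    refine DifferentiableAt.differentiableWithinAt ?_
    refine (Complex.analyticAt_of_differentiable_on_punctured_nhds_of_continuousAt ?_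
      ?_).differentiableAt
    · have hmem : Metric.ball z (2 * ε) ∩ verticalStrip η ∈ 𝓝 z :=
        (Metric.isOpen_ball.inter (isOpen_verticalStrip η)).mem_nhds hz
      filter_upwards [mem_nhdsWithin_of_mem_nhds hmem, self_mem_nhdsWithin] with w hw hwz
      exact hoff w hw hwz
    · exact continuousAt_update_same.2 hr
  · exact (hoff z hz hza).differentiableWithinAt

/-- The maximum principle reduces to the circle of radius `ε` about `a`. By the separation `2 * ε`,
that circle stays at distance at least `ε` from every pole, so the growth bound on `U` applies. -/
lemma norm_poleRemoved_le (hU : InClassL η U) {ε C : ℝ} {L : ℕ} (hε : 0 < ε) (hC : 0 ≤ C)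
    (hsep : ∀ a ∈ stripPoles η U, ∀ b ∈ stripPoles η U, a ≠ b → 2 * ε ≤ dist a b)
    (hgr : ∀ z ∈ verticalStrip η, (∀ a ∈ stripPoles η U, ε ≤ dist z a) →
      ‖U z‖ ≤ C * (1 + ‖z‖) ^ L)
    {a r : ℂ} (ha : a ∈ stripPoles η U) (hr : HasSimpleResidue U a r) (haη : |a.re| + ε < η)
    {z : ℂ} (hz : z ∈ Metric.closedBall a ε) :
    ‖poleRemoved U a r z‖ ≤ ε * C * (1 + ε) ^ L * (1 + ‖a‖) ^ L := by
  refine Complex.norm_le_of_forall_mem_frontier_norm_le Metric.isBounded_ball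
    (((hU.differentiableOn_poleRemoved hsep ha hr).mono
      (closedBall_subset_ball_inter_verticalStrip hε haη)).diffContOnCl_ball subset_rfl) (fun w hw => ?_)
      (by rwa [closure_ball _ hε.ne'])
  rw [frontier_ball _ hε.ne'] at hw
  have hwn := mem_sphere_iff_norm.1 hw
  have hwa : w ≠ a := by
    rintro rfl
    simp at hwn
    exact hε.ne hwn
  have hws := (closedBall_subset_ball_inter_verticalStrip hε haη (Metric.sphere_subset_closedBall hw)).2
  have hd : ∀ b ∈ stripPoles η U, ε ≤ dist w b := by
    intro b hb
    by_cases hab : a = b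
    · rw [← hab, Metric.mem_sphere.1 hw]
    · have h1 := hsep a ha b hb hab
      have h2 := dist_triangle_left a b w
      rw [Metric.mem_sphere.1 hw] at h2
      linarith
  rw [poleRemoved_of_ne U r hwa, norm_mul, hwn, mul_assoc, mul_assoc, ← mul_pow]
  gcongr
  refine (hgr w hws hd).trans ?_
  gcongr
  have h3 : ‖w‖ ≤ ‖w - a‖ + ‖a‖ := by simpa using norm_add_le (w - a) a
  nlinarith [norm_nonneg a]

/-- `U` grows at most polynomially on the imaginary axis. -/
lemma exists_norm_le_on_axis (hU : InClassL η U) (hη : 0 < η) :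
    ∃ (C : ℝ) (L : ℕ), ∀ ξ : ℝ, ‖U (Complex.I * ξ)‖ ≤ C * (1 + ‖ξ‖) ^ L := by
  obtain ⟨ε, C, L, hε, hC, hεη, hsep, hgr⟩ := hU.exists_growth
  obtain ⟨s, L₁, hs, hre⟩ := hU.exists_le_neg_re
  obtain ⟨_, _, _, hres⟩ := hU.exists_residue
  set D := ε * C * (1 + ε) ^ L * (1 + ε) ^ (L + L₁) / s
  have hD : 0 ≤ D := by positivity
  refine ⟨C + D, L + (L + L₁), fun ξ => ?_⟩
  have hnorm : ‖Complex.I * (ξ : ℂ)‖ = ‖ξ‖ := by simp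
  have h1ξ : 1 ≤ 1 + ‖ξ‖ := by linarith [norm_nonneg ξ]
  -- Away from the poles the growth condition applies directly. Within `ε` of a pole `a`, `(z - a)
  -- U(z)` is polynomially bounded, and `|z - a| ≥ -Re a` is polynomially bounded below.
  by_cases h : ∀ a ∈ stripPoles η U, ε ≤ dist (Complex.I * ξ) a
  · refine (hgr _ (by simpa [verticalStrip] using hη) h).trans ?_
    rw [hnorm]
    gcongr
    · linarith
    · omega
  · push Not at h
    obtain ⟨a, ha, hda⟩ := h
    obtain ⟨r, hr, -⟩ := hres a ha
    have hneg := hU.re_neg ha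
    have hle : -a.re ≤ dist (Complex.I * ξ) a := by
      have := Complex.abs_re_le_norm (Complex.I * ξ - a)
      rw [dist_eq_norm]
      refine le_trans ?_ this
      simp [abs_of_neg hneg]
    have hne : Complex.I * ξ ≠ a := by
      intro h
      rw [h, dist_self] at hle
      linarith
    have hV := hU.norm_poleRemoved_le hε hC hsep hgr ha hr
      (by rw [abs_of_neg hneg]; linarith) (Metric.mem_closedBall.2 hda.le)
    rw [poleRemoved_of_ne U r hne, norm_mul, ← dist_eq_norm] at hV
    have hna : 1 + ‖a‖ ≤ (1 + ε) * (1 + ‖ξ‖) := by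
      have h3 : ‖a‖ ≤ ‖a - Complex.I * ξ‖ + ‖Complex.I * (ξ : ℂ)‖ := by
        simpa using norm_add_le (a - Complex.I * ξ) (Complex.I * ξ)
      rw [← dist_eq_norm, dist_comm, hnorm] at h3
      nlinarith [norm_nonneg ξ]
    have hsU : s * ‖U (Complex.I * ξ)‖ ≤
        ε * C * (1 + ε) ^ L * ((1 + ε) * (1 + ‖ξ‖)) ^ (L + L₁) := by
      calc s * ‖U (Complex.I * ξ)‖
          ≤ (1 + ‖a‖) ^ L₁ * (-a.re) * ‖U (Complex.I * ξ)‖ := by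
            gcongr
            exact hre a ha
        _ ≤ (1 + ‖a‖) ^ L₁ * (dist (Complex.I * ξ) a * ‖U (Complex.I * ξ)‖) := by
            rw [mul_assoc]
            gcongr
        _ ≤ (1 + ‖a‖) ^ L₁ * (ε * C * (1 + ε) ^ L * (1 + ‖a‖) ^ L) := by gcongr
        _ = ε * C * (1 + ε) ^ L * (1 + ‖a‖) ^ (L + L₁) := by ring
        _ ≤ _ := by gcongr
    calc ‖U (Complex.I * ξ)‖
        ≤ ε * C * (1 + ε) ^ L * ((1 + ε) * (1 + ‖ξ‖)) ^ (L + L₁) / s := by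
          rw [le_div_iff₀ hs, mul_comm]
          exact hsU
      _ = D * (1 + ‖ξ‖) ^ (L + L₁) := by
          rw [mul_pow]
          ring
      _ ≤ _ := by
          gcongr
          · linarith
          · omega

lemma continuous_on_axis (hU : InClassL η U) (hη : 0 < η) :
    Continuous fun ξ : ℝ => U (Complex.I * ξ) := by
  refine continuous_iff_continuousAt.2 fun ξ => ?_
  have h1 : ContinuousAt U (Complex.I * ξ) := by
    refine (hU.holomorphic_off_poles _ (by simpa [verticalStrip] using hη)
      fun h => ?_).continuousAt
    simpa using hU.re_neg h
  exact ContinuousAt.comp (f := fun ξ : ℝ => Complex.I * (ξ : ℂ)) h1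
    (by fun_prop : Continuous _).continuousAt

end InClassL

/-! ### Upper and lower bounds for derivatives of the multiplied transform -/

lemma norm_iteratedDeriv_mul_fourierLaplace_le {η : ℝ} (hη : 0 < η) {U : ℂ → ℂ}
    (hU : InClassL η U) {ω : ℝ → ℝ} (hω : InOmega ω) {c : ℝ} (hc : 0 < c) {k : ℕ}
    (hck : ∀ x, c * (1 + x ^ 2) ^ (k + 1) ≤ ω x) (F : Lp ℂ 2 (weightMeasure ω))
    (f : 𝓓((⊤ : TopologicalSpace.Opens ℝ), ℂ)) (hF : (F : ℝ → ℂ) =ᵐ[volume] convT U f) (ξ : ℝ) :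
    ‖iteratedDeriv k (fun ξ : ℝ => U (2 * Real.pi * Complex.I * ξ) *
        fourierLaplace f (2 * Real.pi * Complex.I * ξ)) ξ‖ ≤
      (2 * Real.pi) ^ k * (‖F‖ ^ 2 + c⁻¹ * Real.pi) := by
  have hI : ∀ ξ : ℝ, 2 * Real.pi * Complex.I * ξ = Complex.I * (2 * Real.pi * ξ : ℝ) := fun ξ => by
    push_cast
    ring
  simp only [hI, fourierLaplace_eq_fourier]
  obtain ⟨C, L, hC⟩ := hU.exists_norm_le_on_axis hη
  have hC0 : 0 ≤ C := by simpa using (norm_nonneg _).trans (hC 0)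
  have hV : Continuous fun ξ : ℝ => U (Complex.I * (2 * Real.pi * ξ : ℝ)) :=
    (hU.continuous_on_axis hη).comp (by fun_prop : Continuous fun ξ : ℝ => 2 * Real.pi * ξ)
  have hVC : ∀ ξ : ℝ, ‖U (Complex.I * (2 * Real.pi * ξ : ℝ))‖ ≤
      C * (1 + 2 * Real.pi) ^ L * (1 + ‖ξ‖) ^ L := by
    intro ξ
    refine (hC _).trans ?_
    rw [mul_assoc C, ← mul_pow, norm_mul, Real.norm_of_nonneg Real.two_pi_pos.le]
    gcongr
    nlinarith [norm_nonneg ξ, Real.pi_pos]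
  obtain ⟨hcont, hint⟩ := integrable_mul_fourier hV hVC f.contDiff f.hasCompactSupport
  have hmom : ∀ n ≤ k, Integrable fun x => |x| ^ n * ‖F x‖ := fun n hn =>
    (integrable_pow_mul_norm hω hc (fun x => (mul_le_mul_of_nonneg_left
      (pow_le_pow_right₀ (by linarith [sq_nonneg x]) (by omega)) hc.le).trans (hck x)) F).1
  rw [convT_eq_fourierInv] at hF
  refine (norm_iteratedDeriv_le_of_fourierInv hcont hint hF hmom ξ).trans ?_
  gcongr
  exact (integrable_pow_mul_norm hω hc hck F).2

/-- A smooth probability density supported in `[-1, 1]`. -/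
lemma exists_smooth_density : ∃ φ : ℝ → ℝ, ContDiff ℝ ((⊤ : ℕ∞) : WithTop ℕ∞) φ ∧
    HasCompactSupport φ ∧ (∀ x, 0 ≤ φ x) ∧ ∫ x, φ x = 1 ∧
      Function.support φ ⊆ Set.Icc (-1) 1 := by
  let b : ContDiffBump (0 : ℝ) := ⟨1 / 2, 1, by norm_num, by norm_num⟩
  refine ⟨b.normed volume, b.contDiff_normed, b.hasCompactSupport_normed,
    fun x => b.nonneg_normed x, b.integral_normed, ?_⟩
  rw [b.support_normed_eq, Real.ball_eq_Ioo]
  exact (Set.Ioo_subset_Icc_self).trans (by simp [b])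

/-- If a test function is modulated to the height of a pole close to the imaginary axis, the
derivatives of its image under the multiplier `U` blow up polynomially. -/
lemma le_norm_iteratedDeriv_mul_fourierLaplace {η : ℝ} {U : ℂ → ℂ} (hU : InClassL η U)
    {ε C : ℝ} {L : ℕ} (hε : 0 < ε) (hC : 0 ≤ C) (hεη : 2 * ε < η)
    (hsep : ∀ a ∈ stripPoles η U, ∀ b ∈ stripPoles η U, a ≠ b → 2 * ε ≤ dist a b)
    (hgr : ∀ z ∈ verticalStrip η, (∀ a ∈ stripPoles η U, ε ≤ dist z a) →
      ‖U z‖ ≤ C * (1 + ‖z‖) ^ L)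
    {φ : ℝ → ℝ} (hφ : Continuous φ) (hφc : HasCompactSupport φ)
    (hφ0 : ∀ x, 0 ≤ φ x) (hφ1 : ∫ x, φ x = 1) (hφs : ∀ x, φ x ≠ 0 → |x| ≤ 1)
    {a r : ℂ} (ha : a ∈ stripPoles η U) (hr : HasSimpleResidue U a r) (haε : -a.re ≤ ε / 2)
    (k : ℕ) :
    (2 * Real.pi) ^ k * (k.factorial * (‖r‖ * Real.exp (-η) / (-a.re) ^ (k + 1) -
        2 * (ε * C * (1 + ε) ^ L * (1 + ‖a‖) ^ L * Real.exp η) / ε / (ε / 2) ^ k)) ≤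
      ‖iteratedDeriv k (fun ξ : ℝ => U (2 * Real.pi * Complex.I * ξ) *
        fourierLaplace (modulate φ a.im) (2 * Real.pi * Complex.I * ξ))
          (a.im / (2 * Real.pi))‖ := by
  have hneg := hU.re_neg ha
  have hφi : Integrable φ := hφ.integrable_of_hasCompactSupport hφc
  have habs : |a.re| = -a.re := abs_of_neg hneg
  have haη : |a.re| + ε < η := by linarith
  set S := Metric.ball a (2 * ε) ∩ verticalStrip η
  have hS : IsOpen S := Metric.isOpen_ball.inter (isOpen_verticalStrip η)
  have hmc : Continuous (modulate φ a.im) := by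
    unfold modulate
    fun_prop
  have hms : HasCompactSupport (modulate φ a.im) :=
    (hφc.comp_left (g := fun x : ℝ => (x : ℂ)) (by simp)).mul_left
  set f := fourierLaplace (modulate φ a.im)
  have hf : Differentiable ℂ f := differentiable_fourierLaplace hmc hms
  set G := fun z => poleRemoved U a r z * f z
  have hG : DifferentiableOn ℂ G S :=
    (hU.differentiableOn_poleRemoved hsep ha hr).mul hf.differentiableOn
  have hsub : Metric.closedBall a ε ⊆ S := closedBall_subset_ball_inter_verticalStrip hε haη
  have hB : ∀ z ∈ Metric.closedBall a ε,
      ‖G z‖ ≤ ε * C * (1 + ε) ^ L * (1 + ‖a‖) ^ L * Real.exp η := by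
    intro z hz
    rw [norm_mul]
    gcongr
    · exact hU.norm_poleRemoved_le hε hC hsep hgr ha hr haη hz
    · refine (norm_fourierLaplace_modulate_le hφ0 hφi hφ1 hφs _ _).trans ?_
      gcongr
      exact (hsub hz).2.le
  have hGa : ‖r‖ * Real.exp (-η) ≤ ‖G a‖ := by
    simp only [G]
    rw [norm_mul, poleRemoved_self]
    gcongr
    refine le_trans ?_ (le_norm_fourierLaplace_modulate hφ hφc hφ0 hφ1 hφs a)
    gcongr
    linarith
  set z₀ : ℂ := 2 * Real.pi * Complex.I * ((a.im / (2 * Real.pi) : ℝ) : ℂ)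
  have hz₀ : z₀ = Complex.I * a.im := by
    have : (Real.pi : ℂ) ≠ 0 := by exact_mod_cast Real.pi_ne_zero
    simp only [z₀]
    push_cast
    field_simp
  have hdist : dist z₀ a = -a.re := by
    have : z₀ - a = ((-a.re : ℝ) : ℂ) := by
      rw [hz₀]
      push_cast
      linear_combination Complex.re_add_im a
    rw [dist_eq_norm, this, Complex.norm_real, Real.norm_of_nonneg (by linarith)]
  have hne : z₀ ≠ a := by
    rw [← dist_pos, hdist]
    linarith
  have hz₀S : z₀ ∈ S \ {a} :=
    ⟨hsub (by rw [Metric.mem_closedBall, hdist]; linarith), hne⟩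
  -- `U f̂` is differentiated on the punctured domain, where it equals `G z / (z - a)` whatever
  -- value `U` takes at `a`.
  have hS' : IsOpen (S \ {a}) := hS.sdiff isClosed_singleton
  have heq : Set.EqOn (fun z => U z * f z) (fun z => G z / (z - a)) (S \ {a}) := by
    intro z hz
    have : z - a ≠ 0 := sub_ne_zero.2 hz.2
    simp only [G]
    rw [poleRemoved_of_ne U r hz.2]
    field_simp
  have hH : DifferentiableOn ℂ (fun z => U z * f z) (S \ {a}) := by
    refine DifferentiableOn.congr ?_ heq
    exact (hG.mono Set.sdiff_subset).div (by fun_prop) fun z hz => sub_ne_zero.2 hz.2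
  have hmain := le_norm_iteratedDeriv_div_sub hS hG hε hsub hB hne (by rwa [hdist]) k
  rw [iteratedDeriv_comp_const_mul_ofReal hS' hH (2 * Real.pi * Complex.I) k hz₀S,
    (heq.eventuallyEq_of_mem (hS'.mem_nhds hz₀S)).iteratedDeriv_eq k, norm_mul, norm_pow]
  have h2 : ‖2 * (Real.pi : ℂ) * Complex.I‖ = 2 * Real.pi := by
    simp [abs_of_pos Real.pi_pos]
  rw [h2]
  gcongr
  refine le_trans ?_ hmain
  rw [hdist]
  have : 0 < -a.re := by linarith
  gcongr

/-! ### Comparison of the two bounds -/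

theorem mainTheorem5 (η : ℝ) (hη : 0 < η) (U : ℂ → ℂ) (hU : InClassL η U)
    (ω : ℝ → ℝ) (hω : InOmega ω) (hconv : ConvContinuous U ω) :
    NotFasterThanPolynomials ω := by
  by_contra hnot
  obtain ⟨P, hP⟩ := hconv
  obtain ⟨φ, hφ, hφc, hφ0, hφ1, hφs⟩ := exists_smooth_density
  let K : TopologicalSpace.Compacts ℝ := ⟨Set.Icc (-1) 1, isCompact_Icc⟩
  have hK : Function.support φ ⊆ K := hφs
  obtain ⟨A, m, hA, hPm⟩ := exists_norm_modulate_le P hφ hK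
  obtain ⟨ε, C, L, hε, hC, hεη, hsep, hgr⟩ := hU.exists_growth
  obtain ⟨c₀, L₀, hc₀, hres⟩ := hU.exists_residue
  obtain ⟨l₂, hl₂, hfar⟩ := hU.exists_pole_near_axis
  -- The exponents `m`, `L`, `L₀`, `l₂` are fixed before `k`. The extra `+ 1` leaves a spare factor
  -- `T`, which yields the contradiction.
  obtain ⟨k, hk⟩ := exists_nat_ge ((L₀ + L + 2 * m + 1 : ℕ) / l₂)
  obtain ⟨c, hc, hck⟩ := exists_lower_bound_of_not_notFasterThanPolynomials hω hnot (k + 1)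
  set D := 2 * (ε * C * (1 + ε) ^ L * Real.exp η) / ε / (ε / 2) ^ k
  have hD : 0 ≤ D := by positivity
  set M := (D + A ^ 2 + c⁻¹ * Real.pi) / (c₀ * Real.exp (-η)) + 1
  -- The threshold `M` defeats the final inequality; the other one forces `T ^ l₂ ≥ 2 / ε`, hence
  -- `-Re a ≤ ε / 2`.
  obtain ⟨a, ha, haM, hal⟩ := hfar (max M ((2 / ε) ^ (1 / l₂)))
  obtain ⟨r, hr, hrc⟩ := hres a ha
  have hneg : 0 < -a.re := by linarith [hU.re_neg ha]
  set T := 1 + ‖a‖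
  have hT1 : 1 ≤ T := by simp [T]
  have hT0 : 0 < T := by linarith
  have haε : -a.re ≤ ε / 2 := by
    have h1 : 2 / ε ≤ T ^ l₂ := by
      have := Real.rpow_le_rpow (by positivity) ((le_max_right _ _).trans haM) hl₂.le
      rwa [← Real.rpow_mul (by positivity), one_div_mul_cancel hl₂.ne', Real.rpow_one] at this
    have h2 : 2 / ε * (-a.re) ≤ 1 := (by gcongr : _ ≤ _).trans hal
    calc -a.re = ε / 2 * (2 / ε * (-a.re)) := by field_simp
      _ ≤ ε / 2 * 1 := by gcongr
      _ = ε / 2 := mul_one _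
  have hlow := le_norm_iteratedDeriv_mul_fourierLaplace hU hε hC hεη hsep hgr hφ.continuous hφc
    hφ0 hφ1 (fun x hx => abs_le.2 (hφs hx)) ha hr haε k
  have hup := norm_iteratedDeriv_mul_fourierLaplace_le hη hU hω hc hck _ _
    (hP (TestFunction.ofSupportedIn (by simp) (modulateOn hφ hK a.im))) (a.im / (2 * Real.pi))
  have h1 := le_of_mul_le_mul_left (hlow.trans hup) (by positivity)
  have hPT : ‖P (TestFunction.ofSupportedIn (by simp) (modulateOn hφ hK a.im))‖ ≤ A * T ^ m := by
    refine (hPm a.im).trans ?_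
    have := Complex.abs_im_le_norm a
    gcongr
    exact add_le_add_right this 1
  have h2 : ‖r‖ * Real.exp (-η) / (-a.re) ^ (k + 1) - D * T ^ L ≤
      A ^ 2 * T ^ (2 * m) + c⁻¹ * Real.pi := by
    set X := ‖r‖ * Real.exp (-η) / (-a.re) ^ (k + 1) - D * T ^ L
    have hX : k.factorial * X ≤ A ^ 2 * T ^ (2 * m) + c⁻¹ * Real.pi := by
      calc k.factorial * X = _ := by
            simp only [X, D]
            congr 2
            ring
        _ ≤ _ := h1
        _ ≤ (A * T ^ m) ^ 2 + c⁻¹ * Real.pi := by gcongr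
        _ = _ := by ring
    -- The factor `k!` may be dropped: if `X ≤ 0` the bound is trivial, otherwise `X ≤ k! X`.
    rcases le_total X 0 with h0 | h0
    · exact h0.trans (by positivity)
    · refine le_trans ?_ hX
      exact le_mul_of_one_le_left h0 (by exact_mod_cast k.factorial_pos)
  have h3 : T ^ (L₀ + L + 2 * m + 1) * (-a.re) ^ (k + 1) ≤ 1 := by
    have h4 : T ^ (L₀ + L + 2 * m + 1) ≤ (T ^ l₂) ^ (k + 1) := by
      rw [← Real.rpow_natCast, ← Real.rpow_natCast, ← Real.rpow_mul hT0.le]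
      refine Real.rpow_le_rpow_of_exponent_le hT1 ?_
      rw [div_le_iff₀ hl₂] at hk
      refine hk.trans ?_
      push_cast
      nlinarith
    calc _ ≤ (T ^ l₂) ^ (k + 1) * (-a.re) ^ (k + 1) := by gcongr
      _ = (T ^ l₂ * (-a.re)) ^ (k + 1) := (mul_pow _ _ _).symm
      _ ≤ 1 := pow_le_one₀ (by positivity) hal
  have h5 : c₀ * Real.exp (-η) * T * T ^ (L + 2 * m) ≤
      ‖r‖ * Real.exp (-η) / (-a.re) ^ (k + 1) := by
    rw [le_div_iff₀ (by positivity)]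
    calc _ ≤ ‖r‖ * T ^ L₀ * Real.exp (-η) * T * T ^ (L + 2 * m) * (-a.re) ^ (k + 1) := by gcongr
      _ = ‖r‖ * Real.exp (-η) * (T ^ (L₀ + L + 2 * m + 1) * (-a.re) ^ (k + 1)) := by ring
      _ ≤ ‖r‖ * Real.exp (-η) * 1 := by gcongr
      _ = _ := mul_one _
  have h6 : D * T ^ L + (A ^ 2 * T ^ (2 * m) + c⁻¹ * Real.pi) ≤
      (D + A ^ 2 + c⁻¹ * Real.pi) * T ^ (L + 2 * m) := by
    have e1 : T ^ L ≤ T ^ (L + 2 * m) := pow_le_pow_right₀ hT1 (by omega)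
    have e2 : T ^ (2 * m) ≤ T ^ (L + 2 * m) := pow_le_pow_right₀ hT1 (by omega)
    have e3 : 1 ≤ T ^ (L + 2 * m) := one_le_pow₀ hT1
    calc _ ≤ D * T ^ (L + 2 * m) + (A ^ 2 * T ^ (L + 2 * m) +
          c⁻¹ * Real.pi * T ^ (L + 2 * m)) := by
          have e4 : c⁻¹ * Real.pi ≤ c⁻¹ * Real.pi * T ^ (L + 2 * m) :=
            le_mul_of_one_le_right (by positivity) e3
          linarith [mul_le_mul_of_nonneg_left e1 hD, mul_le_mul_of_nonneg_left e2 (sq_nonneg A)]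
      _ = _ := by ring
  have h7 : c₀ * Real.exp (-η) * T ≤ D + A ^ 2 + c⁻¹ * Real.pi :=
    le_of_mul_le_mul_right (h5.trans (by linarith)) (by positivity : 0 < T ^ (L + 2 * m))
  have h8 : T ≤ (D + A ^ 2 + c⁻¹ * Real.pi) / (c₀ * Real.exp (-η)) := by
    rw [le_div_iff₀ (by positivity), mul_comm]
    exact h7
  have h9 : M ≤ T := (le_max_left _ _).trans haM
  linarith
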